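/- Let $K\ge 1$, $n_1,\dots,n_K\ge 1$, $N=\sum_{k=1}^K n_k$ (the class sizes $n_k$ may be different), let $\lambda_W,\lambda_H,\lambda_b>0$, and let $d>K$. For $W\in\mathbb{R}^{d\times K}$, $H\in\mathbb{R}^{d\times N}$ with columns $h_{ki}$ ($1\le k\le K$, $1\le i\le n_k$) and $b\in\mathbb{R}^K$ put $$\mathcal{L}(W,H,b)=\frac1N\sum_{k=1}^K\sum_{i=1}^{n_k}\ell_{CE}(W^{\top}h_{ki}+b,\,e_k)+\frac{\lambda_W}{2}\|W\|_F^2+\frac{\lambda_H}{2}\|H\|_F^2+\frac{\lambda_b}{2}\|b\|^2,\qquad \ell_{CE}(z,e_k)=\log\sum_{l=1}^K e^{z_l}-z_k .$$ Then $\mathcal{L}$ is a strict saddle function with no spurious local minimum, in the following sense. 1. Every local minimizer of $\mathcal{L}$ is a global minimizer. 2. Every critical point $(W,H,b)$ of $\mathcal{L}$ that is not a local minimizer is a strict saddle point: it is not a local maximizer either, and the Hessian $\nabla^2\mathcal{L}(W,H,b)$ has at least one negative eigenvalue. -/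

import Mathlib

noncomputable section

/-- A point `p` is a critical point of `f`: the gradient of `f` at `p` exists and vanishes. -/
def IsCriticalPoint {E : Type*} [NormedAddCommGroup E] [InnerProductSpace ℝ E] [CompleteSpace E]
    (f : E → ℝ) (p : E) : Prop :=
  HasGradientAt f 0 p

/-- The Hessian of `f` at `p`, as an operator: the derivative of the gradient field. -/
def hessian {E : Type*} [NormedAddCommGroup E] [InnerProductSpace ℝ E] [CompleteSpace E]
    (f : E → ℝ) (p : E) : E →L[ℝ] E :=
  fderiv ℝ (gradient f) p

/-- A strict saddle point: a critical point that is neither a local minimizer nor a local maximizer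
and at which the Hessian has a negative eigenvalue. -/
structure IsStrictSaddle {E : Type*} [NormedAddCommGroup E] [InnerProductSpace ℝ E]
    [CompleteSpace E] (f : E → ℝ) (p : E) : Prop where
  critical : IsCriticalPoint f p
  not_localMin : ¬ IsLocalMin f p
  not_localMax : ¬ IsLocalMax f p
  negative_eigenvalue :
    ∃ μ : ℝ, μ < 0 ∧ Module.End.HasEigenvalue (hessian f p : E →ₗ[ℝ] E) μ

namespace UFM

/-- The samples: `⟨k, i⟩` is the `i`-th sample of class `k`, and class `k` has `n k` samples. -/
abbrev Sample {K : ℕ} (n : Fin K → ℕ) : Type :=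
  (k : Fin K) × Fin (n k)

/-- The space of all parameters `(W, H, b)` with `W ∈ ℝ^{d×K}`, `H ∈ ℝ^{d×N}`, `b ∈ ℝ^K`, with its
Euclidean (Frobenius) structure. The columns of `H` are indexed by the samples. -/
abbrev Param (d : ℕ) {K : ℕ} (n : Fin K → ℕ) : Type :=
  EuclideanSpace ℝ ((Fin d × Fin K) ⊕ (Fin d × Sample n) ⊕ Fin K)

/-- The weight matrix `W`. -/
def weight {d K : ℕ} {n : Fin K → ℕ} (p : Param d n) : Matrix (Fin d) (Fin K) ℝ :=
  Matrix.of fun a k => p (Sum.inl (a, k))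

/-- The feature matrix `H`. -/
def feature {d K : ℕ} {n : Fin K → ℕ} (p : Param d n) : Matrix (Fin d) (Sample n) ℝ :=
  Matrix.of fun a s => p (Sum.inr (Sum.inl (a, s)))

/-- The bias `b`. -/
def bias {d K : ℕ} {n : Fin K → ℕ} (p : Param d n) : Fin K → ℝ :=
  fun k => p (Sum.inr (Sum.inr k))

/-- The cross-entropy `ℓ_CE(z, e_k) = log ∑_l exp(z_l) - z_k`. -/
def crossEntropy {K : ℕ} (z : Fin K → ℝ) (k : Fin K) : ℝ :=
  Real.log (∑ l, Real.exp (z l)) - z k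

/-- The squared Frobenius norm of a matrix. -/
def frobSq {m n : Type*} [Fintype m] [Fintype n] (M : Matrix m n ℝ) : ℝ :=
  ∑ i, ∑ j, M i j ^ 2

/-- The regularized empirical risk of the unconstrained feature model,
`(1/N) ∑_k ∑_i ℓ_CE(Wᵀ h_{ki} + b, e_k) + λ_W/2 ‖W‖_F² + λ_H/2 ‖H‖_F² + λ_b/2 ‖b‖²`,
with `N = ∑_k n_k`. -/
def loss {d K : ℕ} (n : Fin K → ℕ) (lamW lamH lamB : ℝ) (p : Param d n) : ℝ :=
  1 / ((∑ k, n k : ℕ) : ℝ) *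
      ∑ k, ∑ i : Fin (n k),
        crossEntropy
          (fun l => ((weight p).transpose * feature p) l ⟨k, i⟩ + bias p l) k
    + lamW / 2 * frobSq (weight p)
    + lamH / 2 * frobSq (feature p)
    + lamB / 2 * ∑ k, bias p k ^ 2

end UFM

end

/-! At a critical point let G be the gradient of the empirical risk in the logits, and consider Q(u,
v) = ⟨G, u vᵀ⟩ + λ_W/2 ‖u‖² + λ_H/2 ‖v‖² (`rankOneForm`). The sign of Q decides everything.

If Q ≥ 0, the point is a global minimizer (`loss_le_of_rankOneForm_nonneg`). The risk is convex in
the logits, hence lies above its tangent. The part of the resulting lower bound that involves W and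
H is a sum of values of Q over the rows of the competitor, and the critical point equations make the
same sum vanish at the critical point.

If Q(u, v) < 0, then d > K gives a nonzero vector a orthogonal to the columns of W, and criticality
makes it orthogonal to those of H. Along (a uᵀ, a vᵀ, 0) the loss is a function of t² with slope
‖a‖² Q(u, v) at zero (`exists_rankOne_descent`). This excludes a local minimum and makes the Hessian
form negative in that direction. -/

/-- A symmetric operator whose quadratic form takes a negative value has a negative eigenvalue. -/
theorem LinearMap.IsSymmetric.exists_hasEigenvalue_neg {E : Type*} [NormedAddCommGroup E]
    [InnerProductSpace ℝ E] [FiniteDimensional ℝ E] {T : E →ₗ[ℝ] E} (hT : T.IsSymmetric) {v : E}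
    (hv : inner ℝ (T v) v < 0) : ∃ μ : ℝ, μ < 0 ∧ Module.End.HasEigenvalue T μ := by
  by_contra! h
  refine hv.not_ge ?_
  rw [← (hT.eigenvectorBasis rfl).sum_inner_mul_inner]
  refine Finset.sum_nonneg fun i _ => ?_
  have hi : 0 ≤ hT.eigenvalues rfl i :=
    not_lt.1 fun hlt => h _ hlt (hT.hasEigenvalue_eigenvalues rfl i)
  rw [hT v, hT.apply_eigenvectorBasis, inner_smul_right, mul_assoc,
    real_inner_comm (hT.eigenvectorBasis rfl i) v]
  exact mul_nonneg hi (mul_self_nonneg _)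

/-! ### The Hessian as a bilinear form -/

section Hessian

variable {E : Type*} [NormedAddCommGroup E] [InnerProductSpace ℝ E] [CompleteSpace E]
  {f : E → ℝ}

theorem inner_hessian (hf : ContDiff ℝ 2 f) (p v w : E) :
    inner ℝ (hessian f p v) w = fderiv ℝ (fderiv ℝ f) p v w := by
  have hd : DifferentiableAt ℝ (fderiv ℝ f) p :=
    ((hf.fderiv_right (m := 1) (by norm_num)).differentiable (by norm_num)) p
  -- The Riesz isomorphism is conjugate-linear; over ℝ it is repackaged as a linear map so that the
  -- chain rule applies.
  let L : (E →L[ℝ] ℝ) →L[ℝ] E :=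
    { toFun := (InnerProductSpace.toDual ℝ E).symm
      map_add' := map_add _
      map_smul' := fun c x => by simp
      cont := (InnerProductSpace.toDual ℝ E).symm.continuous }
  have h : HasFDerivAt (gradient f) (L.comp (fderiv ℝ (fderiv ℝ f) p)) p :=
    L.hasFDerivAt.comp p hd.hasFDerivAt
  rw [hessian, h.fderiv]
  exact InnerProductSpace.toDual_symm_apply

theorem isSymmetric_hessian (hf : ContDiff ℝ 2 f) (p : E) :
    (hessian f p : E →ₗ[ℝ] E).IsSymmetric := by
  intro v w
  have hs : IsSymmSndFDerivAt ℝ f p := hf.contDiffAt.isSymmSndFDerivAt (by simp)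
  rw [ContinuousLinearMap.coe_coe, inner_hessian hf, real_inner_comm, inner_hessian hf]
  exact hs v w

/-- If `f` restricted to a line through `p` is a `C²` function of the squared parameter, the
second derivative along the line is twice the derivative of that function. -/
theorem inner_hessian_of_comp_sq (hf : ContDiff ℝ 2 f) {p v : E} {F : ℝ → ℝ}
    (hF : ContDiff ℝ 2 F) (h : ∀ t : ℝ, f (p + t • v) = F (t ^ 2)) :
    inner ℝ (hessian f p v) v = 2 * deriv F 0 := by
  rw [inner_hessian hf]
  have hline (t : ℝ) : HasDerivAt (fun t : ℝ => p + t • v) v t := by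
    simpa using ((hasDerivAt_id t).smul_const v).const_add p
  have h1 (t : ℝ) : fderiv ℝ f (p + t • v) v = deriv F (t ^ 2) * (2 * t) := by
    have e1 : HasDerivAt (fun t : ℝ => f (p + t • v)) (fderiv ℝ f (p + t • v) v) t :=
      (hf.differentiable (by norm_num) _).hasFDerivAt.comp_hasDerivAt t (hline t)
    have e2 : HasDerivAt (fun t : ℝ => F (t ^ 2)) (deriv F (t ^ 2) * (2 * t)) t := by
      have := (hF.differentiable (by norm_num) (t ^ 2)).hasDerivAt.comp t (hasDerivAt_pow 2 t)
      simpa [Function.comp_def] using this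
    simp only [h] at e1
    exact e1.unique e2
  have hd : DifferentiableAt ℝ (fderiv ℝ f) (p + (0 : ℝ) • v) :=
    ((hf.fderiv_right (m := 1) (by norm_num)).differentiable (by norm_num)) _
  have e3 : HasDerivAt (fun t : ℝ => fderiv ℝ f (p + t • v) v)
      (fderiv ℝ (fderiv ℝ f) (p + (0 : ℝ) • v) v v) 0 :=
    (ContinuousLinearMap.apply ℝ ℝ v).hasFDerivAt.comp_hasDerivAt (0 : ℝ)
      (hd.hasFDerivAt.comp_hasDerivAt (0 : ℝ) (hline 0))
  have hF' : Differentiable ℝ (deriv F) :=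
    (hF.deriv' (n := 1)).differentiable (by norm_num)
  have e4 : HasDerivAt (fun t : ℝ => deriv F (t ^ 2) * (2 * t)) (2 * deriv F 0) 0 := by
    have a1 := (hF' ((0 : ℝ) ^ 2)).hasDerivAt.comp (0 : ℝ) (hasDerivAt_pow 2 (0 : ℝ))
    have a2 := a1.mul ((hasDerivAt_id (0 : ℝ)).const_mul 2)
    exact a2.congr_deriv (by simp [mul_comm])
  simp only [h1] at e3
  simpa using e3.unique e4

end Hessian

noncomputable section

namespace UFM

/-! ### Cross-entropy: gradient and convexity -/

/-- The derivative of `crossEntropy · k` with respect to the logit `l`: the softmax residual. -/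
def ceGrad {K : ℕ} (z : Fin K → ℝ) (k l : Fin K) : ℝ :=
  Real.exp (z l) / (∑ j, Real.exp (z j)) - if l = k then 1 else 0

theorem sum_exp_pos {K : ℕ} (z : Fin K → ℝ) (k : Fin K) : 0 < ∑ l, Real.exp (z l) :=
  Finset.sum_pos (fun _ _ => Real.exp_pos _) ⟨k, Finset.mem_univ k⟩

theorem sum_ceGrad_mul {K : ℕ} (z w : Fin K → ℝ) (k : Fin K) :
    ∑ l, ceGrad z k l * w l
      = (∑ l, Real.exp (z l) * w l) / (∑ j, Real.exp (z j)) - w k := by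
  simp only [ceGrad, sub_mul, Finset.sum_sub_distrib, div_mul_eq_mul_div, ite_mul, one_mul,
    zero_mul, Finset.sum_ite_eq', Finset.mem_univ, if_true, ← Finset.sum_div]

theorem hasDerivAt_crossEntropy {K : ℕ} {z : ℝ → Fin K → ℝ} {z' : Fin K → ℝ} {t : ℝ}
    (h : ∀ l, HasDerivAt (fun t => z t l) (z' l) t) (k : Fin K) :
    HasDerivAt (fun t => crossEntropy (z t) k) (∑ l, ceGrad (z t) k l * z' l) t := by
  rw [sum_ceGrad_mul]
  exact ((HasDerivAt.fun_sum fun l _ => (h l).exp).log (sum_exp_pos (z t) k).ne').sub (h k)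

/-- Convexity of the cross-entropy, in tangent form. -/
theorem crossEntropy_tangent {K : ℕ} (z z' : Fin K → ℝ) (k : Fin K) :
    crossEntropy z k + ∑ l, ceGrad z k l * (z' l - z l) ≤ crossEntropy z' k := by
  have hS := sum_exp_pos z k
  have hS' := sum_exp_pos z' k
  rw [sum_ceGrad_mul, crossEntropy, crossEntropy]
  set S := ∑ l, Real.exp (z l) with hSdef
  -- `m` is the softmax-weighted mean of `z' - z`. The bound `key` is Jensen's inequality for exp:
  -- its tangent at `m` has a linear term that averages to zero.
  set m := (∑ l, Real.exp (z l) * (z' l - z l)) / S with hm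
  have hsum : ∑ l, Real.exp (z l) * (z' l - z l) = m * S := by rw [hm, div_mul_cancel₀ _ hS.ne']
  have key : S * Real.exp m ≤ ∑ l, Real.exp (z' l) := by
    calc S * Real.exp m
        = ∑ l, Real.exp (z l) * (Real.exp m * (1 + (z' l - z l - m))) := by
          have : ∀ l, Real.exp (z l) * (Real.exp m * (1 + (z' l - z l - m)))
              = Real.exp m * (Real.exp (z l) * (z' l - z l))
                + Real.exp m * (1 - m) * Real.exp (z l) := fun l => by ring
          rw [Finset.sum_congr rfl fun l _ => this l, Finset.sum_add_distrib, ← Finset.mul_sum,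
            ← Finset.mul_sum, hsum, ← hSdef]
          ring
      _ ≤ ∑ l, Real.exp (z' l) := by
          refine Finset.sum_le_sum fun l _ => ?_
          have h1 := Real.add_one_le_exp (z' l - z l - m)
          calc Real.exp (z l) * (Real.exp m * (1 + (z' l - z l - m)))
              ≤ Real.exp (z l) * (Real.exp m * Real.exp (z' l - z l - m)) := by
                gcongr; linarith
            _ = Real.exp (z' l) := by rw [← Real.exp_add, ← Real.exp_add]; congr 1; ring
  have hlog := Real.log_le_log (mul_pos hS (Real.exp_pos m)) key
  rw [Real.log_mul hS.ne' (Real.exp_ne_zero m), Real.log_exp] at hlog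
  linarith

/-! ### Smoothness and first variation of the loss -/

variable {d K : ℕ} {n : Fin K → ℕ} {lamW lamH lamB : ℝ}

/-- The logits `Wᵀ h_s + b` of the sample `s`. -/
def logit (p : Param d n) (s : Sample n) (l : Fin K) : ℝ :=
  ∑ a, weight p a l * feature p a s + bias p l

/-- The gradient of the empirical risk with respect to the logits. -/
def riskGrad (p : Param d n) (s : Sample n) (l : Fin K) : ℝ :=
  1 / ((∑ k, n k : ℕ) : ℝ) * ceGrad (logit p s) s.1 l

theorem loss_eq (p : Param d n) :
    loss n lamW lamH lamB p = 1 / ((∑ k, n k : ℕ) : ℝ) * ∑ s, crossEntropy (logit p s) s.1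
      + lamW / 2 * ∑ a, ∑ l, weight p a l ^ 2 + lamH / 2 * ∑ a, ∑ s, feature p a s ^ 2
      + lamB / 2 * ∑ k, bias p k ^ 2 := by
  rw [loss, Fintype.sum_sigma]
  rfl

theorem weight_add_smul (p q : Param d n) (t : ℝ) (a : Fin d) (l : Fin K) :
    weight (p + t • q) a l = weight p a l + t * weight q a l := rfl

theorem feature_add_smul (p q : Param d n) (t : ℝ) (a : Fin d) (s : Sample n) :
    feature (p + t • q) a s = feature p a s + t * feature q a s := rfl

theorem bias_add_smul (p q : Param d n) (t : ℝ) (k : Fin K) :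
    bias (p + t • q) k = bias p k + t * bias q k := rfl

theorem contDiff_crossEntropy {E : Type*} [NormedAddCommGroup E] [NormedSpace ℝ E] {m : WithTop ℕ∞}
    {z : E → Fin K → ℝ} (hz : ∀ l, ContDiff ℝ m fun p => z p l) (k : Fin K) :
    ContDiff ℝ m fun p => crossEntropy (z p) k :=
  ((ContDiff.sum fun l _ => (hz l).exp).log fun p => (sum_exp_pos (z p) k).ne').sub (hz k)

theorem contDiff_loss {m : WithTop ℕ∞} : ContDiff ℝ m (loss (d := d) n lamW lamH lamB) := by
  have hw (a : Fin d) (l : Fin K) : ContDiff ℝ m fun p : Param d n => weight p a l :=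
    (EuclideanSpace.proj (𝕜 := ℝ) (Sum.inl (a, l)) : Param d n →L[ℝ] ℝ).contDiff
  have hf (a : Fin d) (s : Sample n) : ContDiff ℝ m fun p : Param d n => feature p a s :=
    (EuclideanSpace.proj (𝕜 := ℝ) (Sum.inr (Sum.inl (a, s))) : Param d n →L[ℝ] ℝ).contDiff
  have hb (k : Fin K) : ContDiff ℝ m fun p : Param d n => bias p k :=
    (EuclideanSpace.proj (𝕜 := ℝ) (Sum.inr (Sum.inr k)) : Param d n →L[ℝ] ℝ).contDiff
  have hl (s : Sample n) (l : Fin K) : ContDiff ℝ m fun p : Param d n => logit p s l :=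
    (ContDiff.sum fun a _ => (hw a l).mul (hf a s)).add (hb l)
  have hc (s : Sample n) := contDiff_crossEntropy (hl s) s.1
  rw [show loss (d := d) n lamW lamH lamB = _ from funext loss_eq]
  fun_prop

/-- The derivative of the loss at `p` in the direction `q`. -/
theorem hasDerivAt_loss_line (p q : Param d n) :
    HasDerivAt (fun t : ℝ => loss n lamW lamH lamB (p + t • q))
      (∑ s, ∑ l, riskGrad p s l *
          (∑ a, (weight q a l * feature p a s + weight p a l * feature q a s) + bias q l)
        + lamW * ∑ a, ∑ l, weight p a l * weight q a l
        + lamH * ∑ a, ∑ s, feature p a s * feature q a s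
        + lamB * ∑ k, bias p k * bias q k) 0 := by
  have lin (x y : ℝ) : HasDerivAt (fun t : ℝ => x + t * y) y 0 := by
    simpa using ((hasDerivAt_id (0 : ℝ)).mul_const y).const_add x
  have sq (x y : ℝ) : HasDerivAt (fun t : ℝ => (x + t * y) ^ 2) (2 * (x * y)) 0 := by
    simpa [mul_assoc] using (lin x y).fun_pow 2
  have hl (s : Sample n) (l : Fin K) : HasDerivAt (fun t : ℝ => logit (p + t • q) s l)
      (∑ a, (weight q a l * feature p a s + weight p a l * feature q a s) + bias q l) 0 := by
    have := (HasDerivAt.fun_sum (u := Finset.univ) fun a _ =>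
      (lin (weight p a l) (weight q a l)).fun_mul (lin (feature p a s) (feature q a s))).fun_add
        (lin (bias p l) (bias q l))
    simpa [logit, weight_add_smul, feature_add_smul, bias_add_smul] using this
  have hc (s : Sample n) := hasDerivAt_crossEntropy (hl s) s.1
  have hmain := ((((HasDerivAt.fun_sum (u := Finset.univ) fun s _ => hc s).const_mul
      (1 / ((∑ k, n k : ℕ) : ℝ))).add
    ((HasDerivAt.fun_sum (u := Finset.univ) fun a _ => HasDerivAt.fun_sum (u := Finset.univ)
      fun l _ => sq (weight p a l) (weight q a l)).const_mul (lamW / 2))).add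
    ((HasDerivAt.fun_sum (u := Finset.univ) fun a _ => HasDerivAt.fun_sum (u := Finset.univ)
      fun s _ => sq (feature p a s) (feature q a s)).const_mul (lamH / 2))).add
    ((HasDerivAt.fun_sum (u := Finset.univ) fun k _ =>
      sq (bias p k) (bias q k)).const_mul (lamB / 2))
  simp only [loss_eq, weight_add_smul, feature_add_smul, bias_add_smul]
  refine hmain.congr_deriv ?_
  simp only [riskGrad, zero_smul, add_zero, ← Finset.mul_sum, mul_assoc]
  ring

/-- The variational form of the critical point equations. -/
theorem _root_.IsCriticalPoint.loss_line_eq_zero {p : Param d n}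
    (hp : IsCriticalPoint (loss n lamW lamH lamB) p) (q : Param d n) :
    ∑ s, ∑ l, riskGrad p s l *
          (∑ a, (weight q a l * feature p a s + weight p a l * feature q a s) + bias q l)
        + lamW * ∑ a, ∑ l, weight p a l * weight q a l
        + lamH * ∑ a, ∑ s, feature p a s * feature q a s
        + lamB * ∑ k, bias p k * bias q k = 0 := by
  refine (hasDerivAt_loss_line p q).unique ?_
  have hline : HasDerivAt (fun t : ℝ => p + t • q) q 0 := by
    simpa using ((hasDerivAt_id (0 : ℝ)).smul_const q).const_add p
  have hp' : HasFDerivAt (loss n lamW lamH lamB) (0 : Param d n →L[ℝ] ℝ) (p + (0 : ℝ) • q) := by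
    simpa [IsCriticalPoint, hasGradientAt_iff_hasFDerivAt] using hp
  simpa [Function.comp_def] using hp'.comp_hasDerivAt (0 : ℝ) hline

/-- The parameter with given weights, features and bias. -/
def mkParam (W : Fin d → Fin K → ℝ) (H : Fin d → Sample n → ℝ) (b : Fin K → ℝ) : Param d n :=
  WithLp.toLp 2 (Sum.elim (fun x => W x.1 x.2) (Sum.elim (fun x => H x.1 x.2) b))

@[simp]
theorem weight_mkParam (W : Fin d → Fin K → ℝ) (H : Fin d → Sample n → ℝ) (b : Fin K → ℝ)
    (a : Fin d) (l : Fin K) : weight (mkParam W H b) a l = W a l := rfl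

@[simp]
theorem feature_mkParam (W : Fin d → Fin K → ℝ) (H : Fin d → Sample n → ℝ) (b : Fin K → ℝ)
    (a : Fin d) (s : Sample n) : feature (mkParam W H b) a s = H a s := rfl

@[simp]
theorem bias_mkParam (W : Fin d → Fin K → ℝ) (H : Fin d → Sample n → ℝ) (b : Fin K → ℝ)
    (k : Fin K) : bias (mkParam W H b) k = b k := rfl

/-! ### Critical point equations -/

section Critical

variable {p : Param d n}

/-- The test direction is W itself. Averaged with `feature_eq`, this says that the forms Q at the
rows of (W, H) sum to zero. -/
theorem _root_.IsCriticalPoint.weight_eq (hp : IsCriticalPoint (loss n lamW lamH lamB) p) :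
    ∑ s, ∑ l, riskGrad p s l * ∑ a, weight p a l * feature p a s
      = -(lamW * ∑ a, ∑ l, weight p a l ^ 2) := by
  have := hp.loss_line_eq_zero (mkParam (fun a l => weight p a l) 0 0)
  simp only [weight_mkParam, feature_mkParam, bias_mkParam, Pi.zero_apply, mul_zero, add_zero,
    Finset.sum_const_zero, ← sq] at this
  linarith

theorem _root_.IsCriticalPoint.feature_eq (hp : IsCriticalPoint (loss n lamW lamH lamB) p) :
    ∑ s, ∑ l, riskGrad p s l * ∑ a, weight p a l * feature p a s
      = -(lamH * ∑ a, ∑ s, feature p a s ^ 2) := by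
  have := hp.loss_line_eq_zero (mkParam 0 (fun a s => feature p a s) 0)
  simp only [weight_mkParam, feature_mkParam, bias_mkParam, Pi.zero_apply, mul_zero, add_zero,
    zero_mul, zero_add, Finset.sum_const_zero, ← sq] at this
  linarith

theorem _root_.IsCriticalPoint.bias_eq (hp : IsCriticalPoint (loss n lamW lamH lamB) p)
    (c : Fin K → ℝ) :
    ∑ s, ∑ l, riskGrad p s l * c l = -(lamB * ∑ k, bias p k * c k) := by
  have := hp.loss_line_eq_zero (mkParam 0 0 c)
  simp only [weight_mkParam, feature_mkParam, bias_mkParam, Pi.zero_apply, mul_zero, add_zero,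
    zero_mul, zero_add, Finset.sum_const_zero] at this
  linarith

/-- At a critical point, vectors orthogonal to the columns of `W` are orthogonal to those of
`H`. -/
theorem _root_.IsCriticalPoint.sum_mul_feature_eq_zero (hH : 0 < lamH)
    (hp : IsCriticalPoint (loss n lamW lamH lamB) p) {a : Fin d → ℝ}
    (ha : ∀ l, ∑ x, a x * weight p x l = 0) (s : Sample n) : ∑ x, a x * feature p x s = 0 := by
  have := hp.loss_line_eq_zero
    -- The direction a aᵀH is invisible to Wᵀ, so only λ_H ‖aᵀH‖² survives in the first variation.
    (mkParam 0 (fun x s => a x * ∑ y, a y * feature p y s) 0)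
  have h0 (s : Sample n) (l : Fin K) :
      ∑ x, weight p x l * (a x * ∑ y, a y * feature p y s) = 0 := by
    have : ∀ x, weight p x l * (a x * ∑ y, a y * feature p y s)
        = (a x * weight p x l) * ∑ y, a y * feature p y s := fun x => by ring
    simp only [this, ← Finset.sum_mul, ha, zero_mul]
  simp only [weight_mkParam, feature_mkParam, bias_mkParam, Pi.zero_apply, mul_zero, add_zero,
    zero_mul, zero_add, Finset.sum_const_zero, h0] at this
  have h1 : ∑ s, (∑ y, a y * feature p y s) ^ 2 = 0 := by
    rw [Finset.sum_comm] at this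
    have h2 : ∀ s, ∑ x, feature p x s * (a x * ∑ y, a y * feature p y s)
        = (∑ y, a y * feature p y s) ^ 2 := fun s => by
      rw [sq, Finset.sum_mul]
      exact Finset.sum_congr rfl fun x _ => by ring
    simpa [h2, hH.ne'] using this
  rw [Finset.sum_eq_zero_iff_of_nonneg fun _ _ => sq_nonneg _] at h1
  exact pow_eq_zero_iff two_ne_zero |>.1 (h1 s (Finset.mem_univ s))

end Critical

/-! ### The rank-one form and global optimality -/

/-- Half the second variation of the loss in a rank-one direction `(a uᵀ, a vᵀ, 0)` with a unit
vector `a` orthogonal to the columns of `W` and `H`. -/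
def rankOneForm (lamW lamH : ℝ) (p : Param d n) (u : Fin K → ℝ) (v : Sample n → ℝ) : ℝ :=
  ∑ s, ∑ l, riskGrad p s l * (u l * v s) + lamW / 2 * ∑ l, u l ^ 2 + lamH / 2 * ∑ s, v s ^ 2

/-- A critical point at which the rank-one form is nonnegative is a global minimizer. -/
theorem loss_le_of_rankOneForm_nonneg {p : Param d n}
    (hp : IsCriticalPoint (loss n lamW lamH lamB) p) (hB : 0 < lamB)
    (hform : ∀ u v, 0 ≤ rankOneForm lamW lamH p u v) (q : Param d n) :
    loss n lamW lamH lamB p ≤ loss n lamW lamH lamB q := by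
  have hrisk : 1 / ((∑ k, n k : ℕ) : ℝ) * ∑ s, crossEntropy (logit p s) s.1
      + ∑ s, ∑ l, riskGrad p s l * (logit q s l - logit p s l)
      ≤ 1 / ((∑ k, n k : ℕ) : ℝ) * ∑ s, crossEntropy (logit q s) s.1 := by
    simp only [riskGrad, mul_assoc, ← Finset.mul_sum]
    rw [← mul_add, ← Finset.sum_add_distrib]
    gcongr with s
    exact crossEntropy_tangent _ _ _
  have hsplit : ∑ s, ∑ l, riskGrad p s l * (logit q s l - logit p s l)
      = ∑ s, ∑ l, riskGrad p s l * (∑ a, weight q a l * feature q a s)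
        - ∑ s, ∑ l, riskGrad p s l * (∑ a, weight p a l * feature p a s)
        + ∑ s, ∑ l, riskGrad p s l * (bias q l - bias p l) := by
    simp only [← Finset.sum_sub_distrib, ← Finset.sum_add_distrib]
    refine Finset.sum_congr rfl fun s _ => Finset.sum_congr rfl fun l _ => ?_
    simp only [logit]
    ring
  have hq : 0 ≤ ∑ s, ∑ l, riskGrad p s l * (∑ a, weight q a l * feature q a s)
      + lamW / 2 * ∑ a, ∑ l, weight q a l ^ 2 + lamH / 2 * ∑ a, ∑ s, feature q a s ^ 2 := by
    -- WᵀH is the sum over the d rows of rank-one products, so the form is applied row by row.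
    have := Finset.sum_nonneg fun a (_ : a ∈ Finset.univ) => hform (fun l => weight q a l) (fun s => feature q a s)
    simp only [rankOneForm, Finset.sum_add_distrib, ← Finset.mul_sum] at this
    have hcomm : ∑ s, ∑ l, riskGrad p s l * (∑ a, weight q a l * feature q a s)
        = ∑ a, ∑ s, ∑ l, riskGrad p s l * (weight q a l * feature q a s) := by
      simp only [Finset.mul_sum]
      rw [Finset.sum_comm (s := (Finset.univ : Finset (Fin d)))]
      exact Finset.sum_congr rfl fun s _ => Finset.sum_comm
    rwa [hcomm]
  have hbias : lamB / 2 * ∑ k, bias p k ^ 2 + lamB * ∑ k, bias p k * (bias q k - bias p k)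
      ≤ lamB / 2 * ∑ k, bias q k ^ 2 := by
    have : ∑ k, bias p k ^ 2 + 2 * ∑ k, bias p k * (bias q k - bias p k) ≤ ∑ k, bias q k ^ 2 := by
      rw [Finset.mul_sum, ← Finset.sum_add_distrib]
      exact Finset.sum_le_sum fun k _ => by nlinarith [sq_nonneg (bias q k - bias p k)]
    nlinarith
  have h1 := hp.weight_eq
  have h2 := hp.feature_eq
  have h3 := hp.bias_eq fun k => bias q k - bias p k
  rw [loss_eq, loss_eq]
  linarith

/-! ### Descent along rank-one directions -/

/-- The loss along the rank-one direction `(a uᵀ, a vᵀ, 0)`, as a function of the squared step,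
for `a` orthogonal to the columns of `W` and `H`; here `r = ‖a‖²`. -/
def rankOneProfile (lamW lamH lamB : ℝ) (p : Param d n) (r : ℝ) (u : Fin K → ℝ)
    (v : Sample n → ℝ) (x : ℝ) : ℝ :=
  1 / ((∑ k, n k : ℕ) : ℝ) *
      ∑ s, crossEntropy (fun l => logit p s l + x * (r * (u l * v s))) s.1
    + lamW / 2 * (∑ a, ∑ l, weight p a l ^ 2 + x * (r * ∑ l, u l ^ 2))
    + lamH / 2 * (∑ a, ∑ s, feature p a s ^ 2 + x * (r * ∑ s, v s ^ 2))
    + lamB / 2 * ∑ k, bias p k ^ 2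

theorem contDiff_rankOneProfile {m : WithTop ℕ∞} (p : Param d n) (r : ℝ) (u : Fin K → ℝ)
    (v : Sample n → ℝ) : ContDiff ℝ m (rankOneProfile lamW lamH lamB p r u v) := by
  have hc (s : Sample n) : ContDiff ℝ m fun x : ℝ =>
      crossEntropy (fun l => logit p s l + x * (r * (u l * v s))) s.1 :=
    contDiff_crossEntropy (fun l => by fun_prop) s.1
  unfold rankOneProfile
  fun_prop

theorem hasDerivAt_rankOneProfile (p : Param d n) (r : ℝ) (u : Fin K → ℝ) (v : Sample n → ℝ) :
    HasDerivAt (rankOneProfile lamW lamH lamB p r u v) (r * rankOneForm lamW lamH p u v) 0 := by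
  have lin (x y : ℝ) : HasDerivAt (fun t : ℝ => x + t * y) y 0 := by
    simpa using ((hasDerivAt_id (0 : ℝ)).mul_const y).const_add x
  have hc (s : Sample n) := hasDerivAt_crossEntropy
    (fun l => lin (logit p s l) (r * (u l * v s))) s.1
  have hmain := ((((HasDerivAt.fun_sum (u := Finset.univ) fun s _ => hc s).const_mul
      (1 / ((∑ k, n k : ℕ) : ℝ))).add
    ((lin (∑ a, ∑ l, weight p a l ^ 2) (r * ∑ l, u l ^ 2)).const_mul (lamW / 2))).add
    ((lin (∑ a, ∑ s, feature p a s ^ 2) (r * ∑ s, v s ^ 2)).const_mul (lamH / 2))).add_const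
    (lamB / 2 * ∑ k, bias p k ^ 2)
  refine hmain.congr_deriv ?_
  simp only [rankOneForm, riskGrad, zero_mul, add_zero]
  simp only [mul_left_comm _ r, mul_assoc, ← Finset.mul_sum]
  ring

theorem sum_sum_add_mul_sq {ι : Type*} [Fintype ι] (M : Fin d → ι → ℝ) {a : Fin d → ℝ}
    (ha : ∀ i, ∑ x, a x * M x i = 0) (u : ι → ℝ) (t : ℝ) :
    ∑ x, ∑ i, (M x i + t * (a x * u i)) ^ 2
      = ∑ x, ∑ i, M x i ^ 2 + t ^ 2 * ((∑ x, a x ^ 2) * ∑ i, u i ^ 2) := by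
  have hcross : ∑ x, ∑ i, a x * M x i * u i = 0 := by
    rw [Finset.sum_comm]
    simp only [← Finset.sum_mul, ha, zero_mul, Finset.sum_const_zero]
  have hexp (x : Fin d) (i : ι) : (M x i + t * (a x * u i)) ^ 2
      = M x i ^ 2 + 2 * t * (a x * M x i * u i) + t ^ 2 * (a x ^ 2 * u i ^ 2) := by ring
  simp only [hexp, Finset.sum_add_distrib, ← Finset.mul_sum, hcross]
  rw [← Finset.sum_mul]
  ring

/-- Every term odd in t carries an inner product of a with a column of W or H, hence vanishes; only
t² remains. -/
theorem loss_add_smul_rankOne (p : Param d n) {a : Fin d → ℝ}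
    (haW : ∀ l, ∑ x, a x * weight p x l = 0) (haH : ∀ s, ∑ x, a x * feature p x s = 0)
    (u : Fin K → ℝ) (v : Sample n → ℝ) (t : ℝ) :
    loss n lamW lamH lamB
        (p + t • mkParam (fun x l => a x * u l) (fun x s => a x * v s) 0)
      = rankOneProfile lamW lamH lamB p (∑ x, a x ^ 2) u v (t ^ 2) := by
  have hl (s : Sample n) : logit
      (p + t • mkParam (fun x l => a x * u l) (fun x s => a x * v s) 0) s
      = fun l => logit p s l + t ^ 2 * ((∑ x, a x ^ 2) * (u l * v s)) := by
    funext l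
    have hexp (x : Fin d) :
        (weight p x l + t * (a x * u l)) * (feature p x s + t * (a x * v s))
        = weight p x l * feature p x s + t * v s * (a x * weight p x l)
          + t * u l * (a x * feature p x s) + t ^ 2 * (u l * v s) * a x ^ 2 := by ring
    simp only [logit, weight_add_smul, feature_add_smul, bias_add_smul, weight_mkParam,
      feature_mkParam, bias_mkParam, hexp, Finset.sum_add_distrib, ← Finset.mul_sum, haW, haH,
      Pi.zero_apply]
    ring
  simp only [loss_eq, rankOneProfile, hl, weight_add_smul, feature_add_smul, bias_add_smul,
    weight_mkParam, feature_mkParam, bias_mkParam, sum_sum_add_mul_sq _ haW,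
    sum_sum_add_mul_sq _ haH, Pi.zero_apply, mul_zero, add_zero]

/-- If `K < d`, some nonzero vector is orthogonal to all columns of `W`. -/
theorem exists_orthogonal_weight (hd : K < d) (p : Param d n) :
    ∃ a : Fin d → ℝ, 0 < ∑ x, a x ^ 2 ∧ ∀ l, ∑ x, a x * weight p x l = 0 := by
  have hker : LinearMap.ker (weight p).vecMulLinear ≠ ⊥ :=
    LinearMap.ker_ne_bot_of_finrank_lt (by simpa using hd)
  obtain ⟨a, ha, ha0⟩ := Submodule.exists_mem_ne_zero_of_ne_bot hker
  refine ⟨a, ?_, fun l => congrFun (LinearMap.mem_ker.1 ha) l⟩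
  obtain ⟨x, hx⟩ := Function.ne_iff.1 ha0
  exact Finset.sum_pos' (fun _ _ => sq_nonneg _) ⟨x, Finset.mem_univ x, by simp at hx; positivity⟩

/-- At a critical point where the rank-one form takes a negative value, the loss along some line
is a function of the squared step with negative slope at zero. -/
theorem exists_rankOne_descent (hd : K < d) (hH : 0 < lamH) {p : Param d n}
    (hp : IsCriticalPoint (loss n lamW lamH lamB) p) {u : Fin K → ℝ} {v : Sample n → ℝ}
    (huv : rankOneForm lamW lamH p u v < 0) :
    ∃ (q : Param d n) (F : ℝ → ℝ), ContDiff ℝ 2 F ∧ deriv F 0 < 0 ∧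
      ∀ t : ℝ, loss n lamW lamH lamB (p + t • q) = F (t ^ 2) := by
  obtain ⟨a, ha, haW⟩ := exists_orthogonal_weight hd p
  refine ⟨_, _, contDiff_rankOneProfile p _ u v, ?_,
    loss_add_smul_rankOne p haW (hp.sum_mul_feature_eq_zero hH haW) u v⟩
  rw [(hasDerivAt_rankOneProfile p _ u v).deriv]
  exact mul_neg_of_pos_of_neg ha huv

theorem _root_.not_isLocalMin_of_comp_sq {E : Type*} [NormedAddCommGroup E] [NormedSpace ℝ E]
    {f : E → ℝ} {p v : E} {F : ℝ → ℝ} (hF : deriv F 0 < 0)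
    (h : ∀ t : ℝ, f (p + t • v) = F (t ^ 2)) : ¬ IsLocalMin f p := by
  intro hmin
  -- The step √x turns f along the line into F(x) for x ≥ 0, where F has a negative slope at 0.
  have hlim : Filter.Tendsto (fun x : ℝ => p + √x • v) (nhds 0) (nhds p) := by
    have : Continuous fun x : ℝ => p + √x • v := by fun_prop
    simpa using this.tendsto 0
  have hd : HasDerivAt F (deriv F 0) 0 :=
    -- A nonzero `deriv` is not the default value, so F is differentiable at 0.
    (differentiableAt_of_deriv_ne_zero hF.ne).hasDerivAt
  have hslope := (hasDerivAt_iff_tendsto_slope.1 hd).mono_left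
    (nhdsWithin_mono 0 fun x (hx : x ∈ Set.Ioi (0 : ℝ)) => (ne_of_gt hx : x ≠ 0))
  have h1 := hslope.eventually (gt_mem_nhds hF)
  have h2 := (hlim.eventually hmin).filter_mono (nhdsWithin_le_nhds (s := Set.Ioi (0 : ℝ)))
  obtain ⟨x, ⟨hx1, hx2⟩, hx⟩ := ((h1.and h2).and self_mem_nhdsWithin).exists
  replace hx : 0 < x := hx
  have hp0 : f p = F 0 := by simpa using h 0
  rw [h, Real.sq_sqrt hx.le, hp0] at hx2
  rw [slope_def_field, sub_zero, div_neg_iff] at hx1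
  rcases hx1 with ⟨_, h'⟩ | ⟨h', _⟩ <;> linarith

/-- With v = 0 the logits do not move along the rank-one line, while the penalty on W strictly
grows; u = 1 is nonzero because K ≥ 1. -/
theorem not_isLocalMax_loss (hK : 1 ≤ K) (hd : K < d) (hW : 0 < lamW) (hH : 0 < lamH)
    {p : Param d n} (hp : IsCriticalPoint (loss n lamW lamH lamB) p) :
    ¬ IsLocalMax (loss n lamW lamH lamB) p := by
  intro hmax
  obtain ⟨a, ha, haW⟩ := exists_orthogonal_weight hd p
  have hline := loss_add_smul_rankOne (lamW := lamW) (lamH := lamH) (lamB := lamB) p haW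
    (hp.sum_mul_feature_eq_zero hH haW) (fun _ => 1) (fun _ => 0)
  refine not_isLocalMin_of_comp_sq (f := fun x => -loss n lamW lamH lamB x)
    (F := fun x => -rankOneProfile lamW lamH lamB p (∑ x, a x ^ 2) (fun _ => 1) (fun _ => 0) x)
    ?_ (fun t => congrArg Neg.neg (hline t)) hmax.neg
  rw [(hasDerivAt_rankOneProfile p _ _ _).fun_neg.deriv, neg_lt_zero]
  have hK' : (0 : ℝ) < K := by exact_mod_cast hK
  simp only [rankOneForm]
  simp
  positivity

end UFM

end

/-! ### Conclusion by the sign of the rank-one form -/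

theorem mainTheorem5 (d K : ℕ) (hK : 1 ≤ K) (hd : K < d)
    (n : Fin K → ℕ) (hn : ∀ k, 1 ≤ n k)
    (lamW lamH lamB : ℝ) (hW : 0 < lamW) (hH : 0 < lamH) (hB : 0 < lamB) :
    (∀ p : UFM.Param d n,
        IsLocalMin (UFM.loss n lamW lamH lamB) p →
          ∀ q : UFM.Param d n, UFM.loss n lamW lamH lamB p ≤ UFM.loss n lamW lamH lamB q) ∧
      (∀ p : UFM.Param d n,
        IsCriticalPoint (UFM.loss n lamW lamH lamB) p →
          ¬ IsLocalMin (UFM.loss n lamW lamH lamB) p →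
            IsStrictSaddle (UFM.loss n lamW lamH lamB) p) := by
  have hsmooth : ContDiff ℝ 2 (UFM.loss (d := d) n lamW lamH lamB) := UFM.contDiff_loss
  refine ⟨fun p hmin => ?_, fun p hp hnot => ?_⟩
  · have hp : IsCriticalPoint (UFM.loss n lamW lamH lamB) p := by
      have := (hsmooth.differentiable (by norm_num) p).hasFDerivAt
      rw [hmin.fderiv_eq_zero] at this
      simpa [IsCriticalPoint, hasGradientAt_iff_hasFDerivAt] using this
    refine UFM.loss_le_of_rankOneForm_nonneg hp hB fun u v => not_lt.1 fun huv => ?_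
    obtain ⟨q, F, -, hF, hline⟩ := UFM.exists_rankOne_descent hd hH hp huv
    exact not_isLocalMin_of_comp_sq hF hline hmin
  · obtain ⟨u, v, huv⟩ : ∃ u v, UFM.rankOneForm lamW lamH p u v < 0 := by
      by_contra! h
      exact hnot (Filter.Eventually.of_forall (UFM.loss_le_of_rankOneForm_nonneg hp hB h))
    obtain ⟨q, F, hF, hF0, hline⟩ := UFM.exists_rankOne_descent hd hH hp huv
    refine ⟨hp, hnot, UFM.not_isLocalMax_loss hK hd hW hH hp, ?_⟩
    refine (isSymmetric_hessian hsmooth p).exists_hasEigenvalue_neg (v := q) ?_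
    rw [ContinuousLinearMap.coe_coe, inner_hessian_of_comp_sq hsmooth hF hline]
    linarith
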